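/- A finite directed multigraph $G$ (loops and parallel edges allowed) has vertex set $\{0,\dots,n-1\}$ and is given by $n$ and the list of its edges, each listed once for every time it occurs; $n$ and the end points of the edges are written in unary. Its edge shift $X_G^e$ is the set of all bi-infinite sequences $(e_i)_{i\in\mathbb Z}$ of edges of $G$ such that $e_i$ ends at the initial vertex of $e_{i+1}$ for every $i\in\mathbb Z$. A map $\varphi:X_G^e\to X_H^e$ is a $k$-block code if there are integers $m,a$ with $-m\le a$ and $m+a+1=k$, and a map $\Phi$ from the set of blocks of length $k$ occurring in points of $X_G^e$ to the edge set of $H$, such that $\varphi(x)_i=\Phi(x_{i-m}x_{i-m+1}\cdots x_{i+a})$ for all $x\in X_G^e$ and $i\in\mathbb Z$. A $k$-block conjugacy is a bijective $k$-block code. The $k$-block conjugacy problem for edge shifts is to decide, given finite directed multigraphs $G$ and $H$, whether there is a $k$-block conjugacy $X_G^e\to X_H^e$. Theorem. For every fixed integer $k\ge 1$, the $k$-block conjugacy problem for edge shifts is $\mathsf{GI}$-hard: there is a polynomial-time many-one reduction to it from the Graph Isomorphism problem, which is to decide whether two finite simple undirected graphs, given by their adjacency matrices, are isomorphic. (Consequently,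 every problem that is polynomial-time Turing reducible to Graph Isomorphism is polynomial-time Turing reducible to the $k$-block conjugacy problem for edge shifts.) -/

import Mathlib

/-! ### Shift spaces, sliding block codes and conjugacies -/

namespace SymbolicShift

/-- The block `x_i x_{i+1} ⋯ x_{i+k-1}` of length `k` occurring in `x` at position `i`. -/
def block {A : Type} (x : ℤ → A) (i : ℤ) (k : ℕ) : Fin k → A :=
  fun j => x (i + ((j : ℕ) : ℤ))

/-- The set of all blocks of length `k` that occur in points of `X`. -/
def blocks {A : Type} (X : Set (ℤ → A)) (k : ℕ) : Set (Fin k → A) :=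
  {w | ∃ x ∈ X, ∃ i : ℤ, block x i k = w}

theorem block_mem_blocks {A : Type} {X : Set (ℤ → A)} (x : X) (i : ℤ) (k : ℕ) :
    block (x : ℤ → A) i k ∈ blocks X k :=
  ⟨x, x.2, i, rfl⟩

/-- `φ : X → Y` is a `k`-block code: for some memory `m` and anticipation `a` (integers with
`-m ≤ a` and `m + a + 1 = k`) and some block map `Φ` from the blocks of length `k` of `X` to the
alphabet of `Y`, one has `φ(x)_i = Φ(x_{i-m} ⋯ x_{i+a})` for all `x ∈ X` and `i ∈ ℤ`. -/
def IsBlockCode {A B : Type} {X : Set (ℤ → A)} {Y : Set (ℤ → B)} (k : ℕ) (φ : X → Y) : Prop :=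
  ∃ m a : ℤ, -m ≤ a ∧ m + a + 1 = (k : ℤ) ∧
    ∃ Φ : blocks X k → B, ∀ (x : X) (i : ℤ),
      (φ x : ℤ → B) i = Φ ⟨block (x : ℤ → A) (i - m) k, block_mem_blocks x (i - m) k⟩

/-- There is a `k`-block conjugacy from `X` to `Y`: a bijective `k`-block code. (Between shift
spaces over finite alphabets the inverse of a bijective sliding block code is automatically a
sliding block code, by compactness.) -/
def BlockConjugate {A B : Type} (k : ℕ) (X : Set (ℤ → A)) (Y : Set (ℤ → B)) : Prop :=
  ∃ φ : X → Y, IsBlockCode k φ ∧ Function.Bijective φ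

end SymbolicShift

/-! ### Finite directed multigraphs and their edge shifts -/

/-- A finite directed multigraph on the vertices `0, …, numV - 1`, given by the list of its edges
as pairs `(initial vertex, terminal vertex)`; loops and parallel edges are allowed. -/
structure DiMultigraph where
  numV : ℕ
  edges : List (Fin numV × Fin numV)

namespace DiMultigraph

/-- The edges; parallel edges are distinguished by their position in the list. -/
abbrev Edge (G : DiMultigraph) : Type := Fin G.edges.length

/-- The initial vertex of an edge. -/
def src (G : DiMultigraph) (e : G.Edge) : Fin G.numV := (G.edges.get e).1

/-- The terminal vertex of an edge. -/
def tgt (G : DiMultigraph) (e : G.Edge) : Fin G.numV := (G.edges.get e).2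

/-- The edge shift of `G`: the edge sequences of all bi-infinite walks on `G`. -/
def edgeShift (G : DiMultigraph) : Set (ℤ → G.Edge) :=
  {x | ∀ i : ℤ, G.tgt (x i) = G.src (x (i + 1))}

end DiMultigraph

/-! ### The two decision problems -/

/-- A finite simple undirected graph, on the vertices `0, …, n - 1`. -/
abbrev FinGraph : Type := Σ n : ℕ, SimpleGraph (Fin n)

/-- The Graph Isomorphism problem: are two given finite undirected graphs isomorphic? -/
def GraphIsomorphismProblem (p : FinGraph × FinGraph) : Prop :=
  Nonempty (p.1.2 ≃g p.2.2)

/-- The `k`-block conjugacy problem for edge shifts: given directed multigraphs `G` and `H`, is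
there a `k`-block conjugacy from the edge shift of `G` to the edge shift of `H`? -/
def EdgeBlockConjugacyProblem (k : ℕ) (p : DiMultigraph × DiMultigraph) : Prop :=
  SymbolicShift.BlockConjugate k p.1.edgeShift p.2.edgeShift

/-! ### Encodings of instances as words -/

open Classical in
/-- A graph is written as its adjacency matrix, row by row, each row closed by a comma. -/
noncomputable def encodeFinGraph (G : FinGraph) : List Computability.Γ' :=
  (List.finRange G.1).flatMap fun i =>
    ((List.finRange G.1).map fun j => Computability.Γ'.bit (decide (G.2.Adj i j))) ++
      [Computability.Γ'.comma]

/-- A natural number in unary. -/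
def unaryWord (n : ℕ) : List Computability.Γ' :=
  List.replicate n (Computability.Γ'.bit true)

/-- A directed multigraph is written as its number of vertices followed by the list of its edges
`[s,t]`, each edge once for every time that it occurs, all numbers in unary. -/
def encodeDiMultigraph (G : DiMultigraph) : List Computability.Γ' :=
  unaryWord G.numV ++ G.edges.flatMap fun e =>
    Computability.Γ'.bra :: (unaryWord e.1 ++
      Computability.Γ'.comma :: (unaryWord e.2 ++ [Computability.Γ'.ket]))

/-- A pair is written as the concatenation of its two components, over disjoint alphabets. -/
def encodePair {α Γ : Type} (e : α → List Γ) (p : α × α) : List (Γ ⊕ Γ) :=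
  (e p.1).map Sum.inl ++ (e p.2).map Sum.inr

/-! ### The encodings are injective, so an instance can be recovered from its code -/

theorem unaryWord_append_inj {a b : ℕ} {l l' : List Computability.Γ'} {x y : Computability.Γ'} (hx : x ≠ Computability.Γ'.bit true) (hy : y ≠ Computability.Γ'.bit true)
    (h : unaryWord a ++ x :: l = unaryWord b ++ y :: l') : a = b ∧ x = y ∧ l = l' := by
  induction a generalizing b with
  | zero => cases b with
    | zero => simpa [unaryWord] using h
    | succ b => simp [unaryWord, List.replicate_succ, hx] at h
  | succ a ih => cases b with
    | zero => simp [unaryWord, List.replicate_succ, Ne.symm hy] at h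
    | succ b =>
      have := @ih b (by simpa [unaryWord, List.replicate_succ] using h)
      exact ⟨by rw [this.1], this.2⟩

theorem encodeDiMultigraph_injective : Function.Injective encodeDiMultigraph := by
  have key : ∀ (n : ℕ) (l l' : List (Fin n × Fin n)),
      (l.flatMap fun e => Computability.Γ'.bra :: (unaryWord e.1 ++ Computability.Γ'.comma :: (unaryWord e.2 ++ [Computability.Γ'.ket]))) =
      (l'.flatMap fun e => Computability.Γ'.bra :: (unaryWord e.1 ++ Computability.Γ'.comma :: (unaryWord e.2 ++ [Computability.Γ'.ket])))
      → l = l' := by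
    intro n l
    induction l with
    | nil => intro l' h; cases l' <;> simp_all
    | cons e l ih =>
      intro l' h
      cases l' with
      | nil => simp at h
      | cons e' l' =>
        simp only [List.flatMap_cons, List.cons_append, List.append_assoc, List.cons.injEq,
          true_and] at h
        obtain ⟨h1, -, h2⟩ := unaryWord_append_inj (by simp) (by simp) h
        obtain ⟨h3, -, h4⟩ := unaryWord_append_inj (by simp) (by simp) h2
        rw [ih l' h4, Prod.ext (Fin.ext h1) (Fin.ext h3)]
  rintro ⟨n, l⟩ ⟨n', l'⟩ h
  have hn : n = n' := by
    cases l <;> cases l' <;> simp only [encodeDiMultigraph, List.flatMap_cons, List.flatMap_nil, List.cons_append, List.append_nil] at h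
    · simpa [unaryWord] using congrArg List.length h
    · have := congrArg (fun l => Computability.Γ'.bra ∈ l) h
      simp [unaryWord] at this
    · have := congrArg (fun l => Computability.Γ'.bra ∈ l) h
      simp [unaryWord] at this
    · exact (unaryWord_append_inj (by simp) (by simp) h).1
  subst hn
  rw [key n l l' (List.append_cancel_left h)]

theorem matrixRows_inj {n : ℕ} (f g : Fin n → Fin n → Bool) (L : List (Fin n))
   (h : (L.flatMap fun i => ((List.finRange n).map fun j => Computability.Γ'.bit (f i j)) ++ [Computability.Γ'.comma]) =
    (L.flatMap fun i => ((List.finRange n).map fun j => Computability.Γ'.bit (g i j)) ++ [Computability.Γ'.comma])) :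
    ∀ i ∈ L, ∀ j, f i j = g i j := by
  induction L with
  | nil => simp
  | cons a L ih =>
    simp only [List.flatMap_cons] at h
    obtain ⟨h1, h2⟩ := List.append_inj h (by simp)
    intro i hi j
    rcases List.mem_cons.1 hi with rfl | hi
    · have := List.append_cancel_right h1
      have := (List.map_inj_left.1 this) j (List.mem_finRange j)
      simpa using this
    · exact ih h2 i hi j

theorem encodeFinGraph_injective : Function.Injective encodeFinGraph := by
  rintro ⟨n, G⟩ ⟨n', G'⟩ h
  have hn : n = n' := by
    have := congrArg (List.count Computability.Γ'.comma) h
    have e : ∀ (n : ℕ) (G : SimpleGraph (Fin n)), List.count Computability.Γ'.comma (encodeFinGraph ⟨n, G⟩) = n := by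
      intro n G
      classical
      simp [encodeFinGraph, List.count_flatMap, Function.comp_def, List.count_eq_zero_of_not_mem]
    rwa [e, e] at this
  subst hn
  have := matrixRows_inj _ _ _ h
  congr 1
  ext i j
  simpa using this i (List.mem_finRange i) j

/-! ### Polynomial-time reductions and hardness -/

/-- Polynomial-time many-one reducibility of the decision problem `P`, with instances encoded
by `ea`, to the decision problem `Q`, with instances encoded by `eb`. -/
def PolyTimeReducible {α β Γ₀ Γ₁ : Type} (ea : α → List Γ₀) (P : α → Prop)
    (eb : β → List Γ₁) (Q : β → Prop) : Prop :=
  ∃ f : α → β, (∀ x, P x ↔ Q (f x)) ∧ Nonempty (Turing.TM2ComputableInPolyTime ea eb f)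

/-- A decision problem is GI-hard if the Graph Isomorphism problem reduces to it in polynomial
time. Many-one reductions are used, the strongest of the usual requirements: every problem that is
polynomial-time Turing reducible to Graph Isomorphism is then polynomial-time Turing reducible
to `Q`. -/
def IsGIHard {β Γ₁ : Type} (eb : β → List Γ₁) (Q : β → Prop) : Prop :=
  PolyTimeReducible (encodePair encodeFinGraph) GraphIsomorphismProblem eb Q

/-! A graph is turned into a multigraph whose walks are almost trivial: only loops enter a source
and only loops leave a sink. So a point of the edge shift either repeats one loop forever or crosses
exactly once from a source loop to a sink loop (`constant_or_crossing`). The fixed points are thus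
the loops, and the orbits connecting two distinct fixed points correspond to the edges between their
vertices (`eq_crossingPoint`).

A bijective block code, whatever its window length, commutes with translations and preserves
asymptotics to fixed points. It therefore induces a bijection of the fixed points that respects
"joined by some orbit" and "joined by two different orbits" (`exists_equiv_fixedLetters`). The
doubled edges make the second relation pair each source with the sink of the same vertex, and the
first relation then reads off adjacency; this yields a graph isomorphism (`iso_of_blockConjugate`).
Conversely, an isomorphism renames edges, which is a conjugacy looking at one letter, hence a
`k`-block conjugacy for every `k ≥ 1` (`blockConjugate_of_iso`).

The construction is carried out by an explicit multi-stack machine in cubic time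
(`reachesIn_reduction`). -/

namespace SymbolicShift

/-! ### Block codes as locally determined maps -/

variable {A B : Type} {X : Set (ℤ → A)} {Y : Set (ℤ → B)}

theorem block_eq_iff {A : Type} {x y : ℤ → A} {i j : ℤ} {k : ℕ} :
    block x i k = block y j k ↔ ∀ t : ℕ, t < k → x (i + t) = y (j + t) := by
  constructor
  · intro h t ht
    exact congrFun h ⟨t, ht⟩
  · intro h
    funext t
    exact h t t.2

/-- A map is a block code as soon as its value at a position only depends on a window. -/
theorem isBlockCode_iff {k : ℕ} {φ : X → Y} :
    IsBlockCode k φ ↔ ∃ m a : ℤ, -m ≤ a ∧ m + a + 1 = (k : ℤ) ∧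
      ∀ (x y : X) (i j : ℤ), block (x : ℤ → A) (i - m) k = block (y : ℤ → A) (j - m) k →
        (φ x : ℤ → B) i = (φ y : ℤ → B) j := by
  constructor
  · rintro ⟨m, a, h1, h2, Φ, hΦ⟩
    refine ⟨m, a, h1, h2, fun x y i j h => ?_⟩
    rw [hΦ, hΦ]
    congr 1
    exact Subtype.ext h
  · rintro ⟨m, a, h1, h2, h⟩
    -- A block occurring at position `c` is the window seen from position `c + m`.
    refine ⟨m, a, h1, h2, fun w => (φ ⟨w.2.choose, w.2.choose_spec.1⟩ : ℤ → B)
      (w.2.choose_spec.2.choose + m), fun x i => ?_⟩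
    have hw := block_mem_blocks x (i - m) k
    apply h
    rw [add_sub_cancel_right]
    exact hw.choose_spec.2.choose_spec.symm

/-- Every shift space is `k`-block conjugate to itself, for `k ≥ 1`. -/
theorem blockConjugate_refl {k : ℕ} (hk : 1 ≤ k) (X : Set (ℤ → A)) : BlockConjugate k X X := by
  refine ⟨id, isBlockCode_iff.2 ⟨0, (k : ℤ) - 1, by omega, by omega, fun x y i j h => ?_⟩,
    Function.bijective_id⟩
  simpa using block_eq_iff.1 h 0 (by omega)

/-- Renaming the letters does not affect block conjugacy. -/
theorem BlockConjugate.congr_letters {A' B' : Type} {X' : Set (ℤ → A')} {Y' : Set (ℤ → B')}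
    {k : ℕ} (E : A ≃ A') (F : B ≃ B') (hX : ∀ x : ℤ → A, x ∈ X ↔ E ∘ x ∈ X')
    (hY : ∀ y : ℤ → B, y ∈ Y ↔ F ∘ y ∈ Y') (h : BlockConjugate k X Y) :
    BlockConjugate k X' Y' := by
  obtain ⟨φ, hφ, hb⟩ := h
  obtain ⟨m, a, h1, h2, h3⟩ := isBlockCode_iff.1 hφ
  let eX : X ≃ X' := ((Equiv.refl ℤ).arrowCongr E).subtypeEquiv hX
  let eY : Y ≃ Y' := ((Equiv.refl ℤ).arrowCongr F).subtypeEquiv hY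
  refine ⟨eY ∘ φ ∘ eX.symm, isBlockCode_iff.2 ⟨m, a, h1, h2, fun x y i j h => ?_⟩,
    eY.bijective.comp (hb.comp eX.symm.bijective)⟩
  refine congrArg F (h3 _ _ i j ?_)
  rw [block_eq_iff] at h ⊢
  exact fun t ht => congrArg E.symm (h t ht)

/-! ### Points that connect two fixed points -/

/-- `X` is invariant under all translations. -/
def ShiftInvariant (X : Set (ℤ → A)) : Prop :=
  ∀ x ∈ X, ∀ t : ℤ, (fun i => x (i + t)) ∈ X

/-- The letters `p` whose constant sequence belongs to `X`. -/
def fixedLetters (X : Set (ℤ → A)) : Set A := {p | (fun _ => p) ∈ X}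

/-- `x` is left asymptotic to the constant sequence `p` and right asymptotic to `q`. -/
def Connects (x : ℤ → A) (p q : A) : Prop :=
  (∃ N : ℤ, ∀ i ≤ N, x i = p) ∧ ∃ N : ℤ, ∀ i, N ≤ i → x i = q

/-- Some point of `X` connects `p` to `q`. -/
def Linked (X : Set (ℤ → A)) (p q : A) : Prop := ∃ x ∈ X, Connects x p q

/-- Two points of `X` in different orbits connect `p` to `q`. -/
def TwinLinked (X : Set (ℤ → A)) (p q : A) : Prop :=
  ∃ x ∈ X, ∃ y ∈ X, Connects x p q ∧ Connects y p q ∧ ∀ t : ℤ, y ≠ fun i => x (i + t)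

theorem Connects.unique {x : ℤ → A} {p q p' q' : A} (h : Connects x p q)
    (h' : Connects x p' q') : p = p' ∧ q = q' := by
  obtain ⟨⟨N, hN⟩, M, hM⟩ := h
  obtain ⟨⟨N', hN'⟩, M', hM'⟩ := h'
  exact ⟨(hN (min N N') (min_le_left _ _)).symm.trans (hN' _ (min_le_right _ _)),
    (hM (max M M') (le_max_left _ _)).symm.trans (hM' _ (le_max_right _ _))⟩

/-- A block conjugacy between shift-invariant sets, all points of whose domain connect fixed
points, induces a bijection of the fixed letters that preserves the connection relations. -/
theorem exists_equiv_fixedLetters {k : ℕ} (hX : ShiftInvariant X)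
    (hXc : ∀ x ∈ X, ∃ p ∈ fixedLetters X, ∃ q ∈ fixedLetters X, Connects x p q)
    (h : BlockConjugate k X Y) :
    ∃ σ : fixedLetters X ≃ fixedLetters Y, ∀ p q : fixedLetters X,
      (Linked X p q ↔ Linked Y (σ p) (σ q)) ∧ (TwinLinked X p q ↔ TwinLinked Y (σ p) (σ q)) := by
  obtain ⟨φ, hφ, hinj, hsurj⟩ := h
  obtain ⟨m, a, -, h2, hloc⟩ := isBlockCode_iff.1 hφ
  let c : fixedLetters X → X := fun p => ⟨fun _ => p, p.2⟩
  let s : fixedLetters X → B := fun p => (φ (c p) : ℤ → B) 0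
  have hc : ∀ p, (φ (c p) : ℤ → B) = fun _ => s p := fun p => by
    funext i
    exact hloc _ _ _ _ (block_eq_iff.2 fun _ _ => rfl)
  have hshift : ∀ (x : X) (t : ℤ) (hx : (fun i => (x : ℤ → A) (i + t)) ∈ X),
      (φ ⟨_, hx⟩ : ℤ → B) = fun i => (φ x : ℤ → B) (i + t) := fun x t hx => by
    funext i
    refine hloc _ _ _ _ (block_eq_iff.2 fun r _ => ?_)
    exact congrArg (x : ℤ → A) (by ring)
  have hs : ∀ p, s p ∈ fixedLetters Y := fun p => by
    show (fun _ => s p) ∈ Y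
    rw [← hc]
    exact (φ (c p)).2
  have hbij : Function.Bijective fun p => (⟨s p, hs p⟩ : fixedLetters Y) := by
    constructor
    · intro p q hpq
      have : s p = s q := congrArg Subtype.val hpq
      have h1 : c p = c q := hinj (Subtype.ext (by rw [hc, hc, this]))
      exact Subtype.ext (congrFun (congrArg Subtype.val h1) 0)
    · intro q
      obtain ⟨x, hx⟩ := hsurj ⟨fun _ => (q : B), q.2⟩
      -- All translates of a preimage of a fixed point have the same image, so injectivity makes the
      -- preimage fixed.
      have hxc : ∀ t, (x : ℤ → A) t = (x : ℤ → A) 0 := fun t => by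
        have h1 : (⟨_, hX x x.2 t⟩ : X) = x := hinj (Subtype.ext (by rw [hshift, hx]))
        simpa using congrFun (congrArg Subtype.val h1) 0
      have hx0 : (x : ℤ → A) = fun _ => (x : ℤ → A) 0 := funext hxc
      have hp : (x : ℤ → A) 0 ∈ fixedLetters X := by
        show (fun _ => (x : ℤ → A) 0) ∈ X
        rw [← hx0]
        exact x.2
      refine ⟨⟨_, hp⟩, Subtype.ext ?_⟩
      have h2 : c ⟨_, hp⟩ = x := Subtype.ext hx0.symm
      show (φ (c ⟨_, hp⟩) : ℤ → B) 0 = q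
      rw [h2, hx]
  have hcon : ∀ (x : X) (p q : fixedLetters X), Connects (x : ℤ → A) p q →
      Connects (φ x : ℤ → B) (s p) (s q) := by
    rintro x p q ⟨⟨N, hN⟩, M, hM⟩
    constructor
    -- The window of `i` is `i - m, …, i - m + k - 1`; these bounds place it entirely inside the
    -- constant tail.
    · refine ⟨N + m - k, fun i hi => hloc x (c p) i 0 (block_eq_iff.2 fun t ht => hN _ ?_)⟩
      omega
    · refine ⟨M + m, fun i hi => hloc x (c q) i 0 (block_eq_iff.2 fun t ht => hM _ ?_)⟩
      omega
  -- Since `x` connects some pair of fixed letters, its image connects the images of that pair, and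
  -- uniqueness of the ends identifies the two pairs. No locality of the inverse map is needed.
  have hcon' : ∀ (x : X) (p q : fixedLetters X), Connects (φ x : ℤ → B) (s p) (s q) →
      Connects (x : ℤ → A) p q := by
    intro x p q h
    obtain ⟨p', hp', q', hq', hx⟩ := hXc x x.2
    obtain ⟨e1, e2⟩ := (hcon x ⟨p', hp'⟩ ⟨q', hq'⟩ hx).unique h
    have e1' : (⟨p', hp'⟩ : fixedLetters X) = p := hbij.1 (Subtype.ext e1)
    have e2' : (⟨q', hq'⟩ : fixedLetters X) = q := hbij.1 (Subtype.ext e2)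
    rw [← e1', ← e2']
    exact hx
  refine ⟨Equiv.ofBijective _ hbij, fun p q => ⟨⟨?_, ?_⟩, ⟨?_, ?_⟩⟩⟩
  · rintro ⟨x, hx, h⟩
    exact ⟨_, (φ ⟨x, hx⟩).2, hcon ⟨x, hx⟩ p q h⟩
  · rintro ⟨y, hy, h⟩
    obtain ⟨x, hx⟩ := hsurj ⟨y, hy⟩
    refine ⟨x, x.2, hcon' x p q ?_⟩
    rw [hx]
    exact h
  · rintro ⟨x, hx, y, hy, h, h', hne⟩
    refine ⟨_, (φ ⟨x, hx⟩).2, _, (φ ⟨y, hy⟩).2, hcon ⟨x, hx⟩ p q h, hcon ⟨y, hy⟩ p q h',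
      fun t e => hne t ?_⟩
    rw [← hshift ⟨x, hx⟩ t (hX x hx t)] at e
    exact congrArg Subtype.val (hinj (Subtype.ext e))
  · rintro ⟨x', hx', y', hy', h, h', hne⟩
    obtain ⟨x, hx⟩ := hsurj ⟨x', hx'⟩
    obtain ⟨y, hy⟩ := hsurj ⟨y', hy'⟩
    refine ⟨x, x.2, y, y.2, hcon' x p q (by rw [hx]; exact h), hcon' y p q (by rw [hy]; exact h'),
      fun t e => hne t ?_⟩
    have h1 : y = ⟨_, hX x x.2 t⟩ := Subtype.ext e
    have h2 := hshift x t (hX x x.2 t)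
    rw [← h1, hx, hy] at h2
    exact h2

end SymbolicShift

/-! ### The multigraph of a graph and its edge shift -/

namespace GraphToMultigraph

open SymbolicShift

/-- The edges of the multigraph attached to a graph `G` on `Fin n`. The multigraph has a source
`(i, false)` and a sink `(i, true)` for every vertex `i`, a loop at each of them, two parallel edges
from the source to the sink of `i`, and an edge from the source of `i` to the sink of `j` whenever
`i` and `j` are adjacent. -/
inductive Arrow (n : ℕ)
  | loop (v : Fin n × Bool)
  | link (i : Fin n) (c : Bool)
  | entry (i j : Fin n)
  deriving DecidableEq

namespace Arrow

variable {n : ℕ}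

def src : Arrow n → Fin n × Bool
  | loop v => v
  | link i _ => (i, false)
  | entry i _ => (i, false)

def tgt : Arrow n → Fin n × Bool
  | loop v => v
  | link i _ => (i, true)
  | entry _ j => (j, true)

end Arrow

/-- The index of a source or sink among the vertices of the multigraph. -/
def node {n : ℕ} (v : Fin n × Bool) : Fin (2 * n) :=
  ⟨2 * (v.1 : ℕ) + v.2.toNat, by
    have := v.1.2
    have := Bool.toNat_le v.2
    omega⟩

theorem node_injective {n : ℕ} : Function.Injective (node : Fin n × Bool → Fin (2 * n)) := by
  rintro ⟨i, s⟩ ⟨j, t⟩ h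
  have h' : 2 * (i : ℕ) + s.toNat = 2 * (j : ℕ) + t.toNat := congrArg Fin.val h
  have : (i : ℕ) = j := by
    have := Bool.toNat_le s
    have := Bool.toNat_le t
    omega
  obtain rfl := Fin.ext this
  cases s <;> cases t <;> simp_all

open Classical in
/-- The edges with source in the row `i` of the adjacency matrix. -/
noncomputable def rowArrows {n : ℕ} (G : SimpleGraph (Fin n)) (i : Fin n) : List (Arrow n) :=
  [.link i true, .link i false, .loop (i, true), .loop (i, false)] ++
    (List.finRange n).reverse.flatMap fun j => if G.Adj i j then [.entry i j] else []

/-- Rows, and the columns within a row, are reversed because the machine prepends each new edge to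
its output. -/
noncomputable def arrowList {n : ℕ} (G : SimpleGraph (Fin n)) : List (Arrow n) :=
  (List.finRange n).reverse.flatMap (rowArrows G)

/-- The directed multigraph attached to a finite simple graph. -/
noncomputable def toMultigraph (G : FinGraph) : DiMultigraph where
  numV := 2 * G.1
  edges := (arrowList G.2).map fun t => (node t.src, node t.tgt)

section

variable {n : ℕ} {G : SimpleGraph (Fin n)}

theorem mem_rowArrows {i : Fin n} {t : Arrow n} :
    t ∈ rowArrows G i ↔ t = .loop (i, false) ∨ t = .loop (i, true) ∨ (∃ c, t = .link i c) ∨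
      ∃ j, G.Adj i j ∧ t = .entry i j := by
  simp only [rowArrows, List.mem_append, List.mem_flatMap, List.mem_reverse, List.mem_finRange,
    true_and, List.mem_ite_nil_right, List.mem_cons, List.not_mem_nil,
    or_false, Bool.exists_bool]
  tauto

theorem mem_arrowList {t : Arrow n} :
    t ∈ arrowList G ↔ ∀ i j, t = .entry i j → G.Adj i j := by
  simp only [arrowList, List.mem_flatMap, List.mem_reverse, List.mem_finRange, true_and,
    mem_rowArrows]
  rcases t with ⟨i, _ | _⟩ | ⟨i, c⟩ | ⟨i, j⟩ <;> simp

/-- Edges of a multigraph are positions in its list. Without repetitions, positions correspond to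
arrows, and the two links at a vertex stay distinct although their end points agree. -/
theorem nodup_arrowList : (arrowList G).Nodup := by
  rw [arrowList, List.nodup_flatMap]
  refine ⟨fun i _ => ?_, ?_⟩
  · rw [rowArrows, List.nodup_append']
    refine ⟨by simp, ?_, ?_⟩
    · rw [List.nodup_flatMap]
      refine ⟨fun j _ => by split <;> simp, ?_⟩
      refine List.Pairwise.imp ?_ (List.nodup_reverse.2 (List.nodup_finRange n))
      intro j j' hj
      simp only [Function.onFun, List.disjoint_left]
      intro t ht ht'
      simp only [List.mem_ite_nil_right, List.mem_singleton] at ht ht'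
      rw [ht.2] at ht'
      exact hj (Arrow.entry.inj ht'.2).2
    · rw [List.disjoint_left]
      intro t ht ht'
      simp only [List.mem_flatMap, List.mem_ite_nil_right, List.mem_singleton] at ht'
      obtain ⟨j, -, -, rfl⟩ := ht'
      simp at ht
  · refine List.Pairwise.imp ?_ (List.nodup_reverse.2 (List.nodup_finRange n))
    intro i i' hi
    simp only [Function.onFun, List.disjoint_left, mem_rowArrows]
    rintro t (rfl | rfl | ⟨c, rfl⟩ | ⟨j, -, rfl⟩) <;> simp [hi]

end

/-- The edges of the multigraph attached to `G`, as a type. -/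
abbrev ArrowOf {n : ℕ} (G : SimpleGraph (Fin n)) : Type := {t : Arrow n // t ∈ arrowList G}

/-- The edge shift of the multigraph attached to `G`, over the alphabet `ArrowOf G`. -/
def arrowShift {n : ℕ} (G : SimpleGraph (Fin n)) : Set (ℤ → ArrowOf G) :=
  {x | ∀ i, (x i).1.tgt = (x (i + 1)).1.src}

noncomputable def edgeEquiv (G : FinGraph) : (toMultigraph G).Edge ≃ ArrowOf G.2 :=
  (finCongr (by simp [toMultigraph])).trans (nodup_arrowList.getEquiv _)

theorem mem_edgeShift_iff (G : FinGraph) (x : ℤ → (toMultigraph G).Edge) :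
    x ∈ (toMultigraph G).edgeShift ↔ edgeEquiv G ∘ x ∈ arrowShift G.2 := by
  have hs : ∀ e, (toMultigraph G).src e = node (edgeEquiv G e).1.src := fun e => by
    refine congrArg Prod.fst (List.getElem_map (fun t : Arrow G.1 => (node t.src, node t.tgt)))
  have ht : ∀ e, (toMultigraph G).tgt e = node (edgeEquiv G e).1.tgt := fun e => by
    refine congrArg Prod.snd (List.getElem_map (fun t : Arrow G.1 => (node t.src, node t.tgt)))
  refine forall_congr' fun i => ?_
  rw [ht, hs]
  exact node_injective.eq_iff

theorem blockConjugate_edgeShift_iff {k : ℕ} (G H : FinGraph) :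
    BlockConjugate k (toMultigraph G).edgeShift (toMultigraph H).edgeShift ↔
      BlockConjugate k (arrowShift G.2) (arrowShift H.2) := by
  constructor
  · exact BlockConjugate.congr_letters _ _ (mem_edgeShift_iff G) (mem_edgeShift_iff H)
  · refine BlockConjugate.congr_letters (edgeEquiv G).symm (edgeEquiv H).symm (fun x => ?_)
      fun x => ?_
    · rw [mem_edgeShift_iff, ← Function.comp_assoc, Equiv.self_comp_symm, Function.id_comp]
    · rw [mem_edgeShift_iff, ← Function.comp_assoc, Equiv.self_comp_symm, Function.id_comp]

/-! ### Isomorphic graphs -/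

/-- The effect of a bijection of the vertices on the edges of the multigraphs. -/
def Arrow.map {n m : ℕ} (f : Fin n → Fin m) : Arrow n → Arrow m
  | loop v => loop (f v.1, v.2)
  | link i c => link (f i) c
  | entry i j => entry (f i) (f j)

theorem Arrow.map_map {n m l : ℕ} (f : Fin n → Fin m) (g : Fin m → Fin l) (t : Arrow n) :
    (t.map f).map g = t.map (g ∘ f) := by
  cases t <;> rfl

theorem Arrow.map_id {n : ℕ} (t : Arrow n) : t.map id = t := by
  cases t <;> rfl

section

variable {n m : ℕ} {G : SimpleGraph (Fin n)} {H : SimpleGraph (Fin m)}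

theorem map_mem_arrowList (ψ : G ≃g H) {t : Arrow n} (ht : t ∈ arrowList G) :
    t.map ψ ∈ arrowList H := by
  rw [mem_arrowList] at ht ⊢
  rcases t with v | ⟨i, c⟩ | ⟨i, j⟩ <;> simp only [Arrow.map]
  · simp
  · simp
  · intro i' j' e
    obtain ⟨rfl, rfl⟩ := Arrow.entry.inj e
    exact ψ.map_adj_iff.2 (ht i j rfl)

def arrowEquiv (ψ : G ≃g H) : ArrowOf G ≃ ArrowOf H where
  toFun t := ⟨t.1.map ψ, map_mem_arrowList ψ t.2⟩
  invFun t := ⟨t.1.map ψ.symm, map_mem_arrowList ψ.symm t.2⟩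
  left_inv t := Subtype.ext <| by
    dsimp only
    rw [Arrow.map_map, show ψ.symm ∘ ψ = id from funext ψ.symm_apply_apply, Arrow.map_id]
  right_inv t := Subtype.ext <| by
    dsimp only
    rw [Arrow.map_map, show ψ ∘ ψ.symm = id from funext ψ.apply_symm_apply, Arrow.map_id]

/-- The identity is a `k`-block conjugacy; renaming only the letters of its codomain along the
isomorphism gives the required one. -/
theorem blockConjugate_of_iso {k : ℕ} (hk : 1 ≤ k) (ψ : G ≃g H) :
    BlockConjugate k (arrowShift G) (arrowShift H) := by
  have hs : ∀ t : Arrow n, (t.map ψ).src = (ψ t.src.1, t.src.2) := fun t => by cases t <;> rfl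
  have ht : ∀ t : Arrow n, (t.map ψ).tgt = (ψ t.tgt.1, t.tgt.2) := fun t => by cases t <;> rfl
  refine BlockConjugate.congr_letters (Equiv.refl _) (arrowEquiv ψ) (fun x => Iff.rfl)
    (fun x => ?_) (blockConjugate_refl hk (arrowShift G))
  simp only [arrowShift, Set.mem_ofPred_eq, Function.comp_apply, arrowEquiv, Equiv.coe_fn_mk,
    hs, ht, Prod.ext_iff, ψ.injective.eq_iff]

/-! ### The points of the edge shift -/

variable (G) in
def loopAt (v : Fin n × Bool) : ArrowOf G := ⟨.loop v, by simp [mem_arrowList]⟩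

theorem loopAt_injective : Function.Injective (loopAt G) := fun _ _ h =>
  Arrow.loop.inj (congrArg Subtype.val h)

theorem loopAt_mem_fixedLetters (v : Fin n × Bool) : loopAt G v ∈ fixedLetters (arrowShift G) :=
  fun _ => rfl

theorem eq_loop_of_tgt {t : Arrow n} {i : Fin n} (h : t.tgt = (i, false)) :
    t = .loop (i, false) := by
  rcases t with v | ⟨i, c⟩ | ⟨i, j⟩ <;> simp_all [Arrow.tgt]

theorem eq_loop_of_src {t : Arrow n} {i : Fin n} (h : t.src = (i, true)) :
    t = .loop (i, true) := by
  rcases t with v | ⟨i, c⟩ | ⟨i, j⟩ <;> simp_all [Arrow.src]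

variable {x : ℤ → ArrowOf G}

/-- Going backwards from a source, the only edge available at each step is the loop there. -/
theorem eq_loopAt_of_le (hx : x ∈ arrowShift G) {N i : ℤ} {u : Fin n}
    (h : (x N).1.src = (u, false)) (hi : i < N) : x i = loopAt G (u, false) := by
  have key : ∀ d : ℕ, x (N - 1 - d) = loopAt G (u, false) := by
    intro d
    induction d with
    | zero =>
      refine Subtype.ext (eq_loop_of_tgt ((hx _).trans ?_))
      simpa using h
    | succ d ih =>
      refine Subtype.ext (eq_loop_of_tgt ((hx _).trans ?_))
      rw [show N - 1 - ((d + 1 : ℕ) : ℤ) + 1 = N - 1 - d by push_cast; ring, ih]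
      rfl
  have := key (N - 1 - i).toNat
  rwa [show N - 1 - ((N - 1 - i).toNat : ℤ) = i by omega] at this

theorem eq_loopAt_of_ge (hx : x ∈ arrowShift G) {N i : ℤ} {u : Fin n}
    (h : (x N).1.tgt = (u, true)) (hi : N < i) : x i = loopAt G (u, true) := by
  have key : ∀ d : ℕ, x (N + d + 1) = loopAt G (u, true) := by
    intro d
    induction d with
    | zero =>
      refine Subtype.ext (eq_loop_of_src ((hx _).symm.trans ?_))
      simpa using h
    | succ d ih =>
      refine Subtype.ext (eq_loop_of_src ((hx _).symm.trans ?_))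
      rw [show N + ((d + 1 : ℕ) : ℤ) = N + d + 1 by push_cast; ring, ih]
      rfl
  have := key (i - N - 1).toNat
  rwa [show N + ((i - N - 1).toNat : ℤ) + 1 = i by omega] at this

/-- A point is constant, or it changes from a loop at a source to a loop at a sink by passing once
through an edge between them. -/
theorem constant_or_crossing (hx : x ∈ arrowShift G) :
    (∃ v, x = fun _ => loopAt G v) ∨ ∃ (N : ℤ) (u w : Fin n), (x N).1.src = (u, false) ∧
      (x N).1.tgt = (w, true) := by
  by_cases h : ∃ (N : ℤ) (u w : Fin n), (x N).1.src = (u, false) ∧ (x N).1.tgt = (w, true)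
  · exact Or.inr h
  · left
    have hl : ∀ i, ∃ v, x i = loopAt G v := by
      intro i
      push Not at h
      rcases hxi : x i with ⟨v | ⟨a, c⟩ | ⟨a, b⟩, ht⟩
      · exact ⟨v, rfl⟩
      · exact absurd (by rw [hxi]; rfl) (h i a a (by rw [hxi]; rfl))
      · exact absurd (by rw [hxi]; rfl) (h i a b (by rw [hxi]; rfl))
    choose v hv using hl
    have hstep : ∀ i, v i = v (i + 1) := fun i => by
      have := hx i
      rw [hv, hv] at this
      exact this
    refine ⟨v 0, funext fun i => ?_⟩
    rw [hv]
    congr 1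
    induction i with
    | zero => rfl
    | succ i ih => rw [← hstep, ih]
    | pred i ih => rw [← ih, hstep]; simp

theorem connects_of_crossing (hx : x ∈ arrowShift G) {N : ℤ} {u w : Fin n}
    (hs : (x N).1.src = (u, false)) (ht : (x N).1.tgt = (w, true)) :
    Connects x (loopAt G (u, false)) (loopAt G (w, true)) :=
  ⟨⟨N - 1, fun _ hi => eq_loopAt_of_le hx hs (by omega)⟩,
    N + 1, fun _ hi => eq_loopAt_of_ge hx ht (by omega)⟩

theorem exists_connects (hx : x ∈ arrowShift G) : ∃ p ∈ fixedLetters (arrowShift G),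
    ∃ q ∈ fixedLetters (arrowShift G), Connects x p q := by
  rcases constant_or_crossing hx with ⟨v, rfl⟩ | ⟨N, u, w, hs, ht⟩
  · exact ⟨_, loopAt_mem_fixedLetters v, _, loopAt_mem_fixedLetters v, ⟨0, fun _ _ => rfl⟩,
      0, fun _ _ => rfl⟩
  · exact ⟨_, loopAt_mem_fixedLetters _, _, loopAt_mem_fixedLetters _,
      connects_of_crossing hx hs ht⟩

/-- A point that connects distinct fixed points crosses from a source to a sink. -/
theorem exists_crossing (hx : x ∈ arrowShift G) {p q : ArrowOf G} (h : Connects x p q)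
    (hpq : p ≠ q) : ∃ (N : ℤ) (u w : Fin n), p = loopAt G (u, false) ∧ q = loopAt G (w, true) ∧
      (x N).1.src = (u, false) ∧ (x N).1.tgt = (w, true) := by
  rcases constant_or_crossing hx with ⟨v, rfl⟩ | ⟨N, u, w, hs, ht⟩
  · obtain ⟨e1, e2⟩ := h.unique ⟨⟨0, fun _ _ => rfl⟩, 0, fun _ _ => rfl⟩
    exact absurd (e1.trans e2.symm) hpq
  · obtain ⟨e1, e2⟩ := h.unique (connects_of_crossing hx hs ht)
    exact ⟨N, u, w, e1, e2, hs, ht⟩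

/-- The point that crosses from `u` to `w` through `t` at the time `0`. -/
def crossingPoint (t : ArrowOf G) : ℤ → ArrowOf G := fun i =>
  if i < 0 then loopAt G t.1.src else if i = 0 then t else loopAt G t.1.tgt

theorem crossingPoint_mem (t : ArrowOf G) : crossingPoint t ∈ arrowShift G := by
  intro i
  rcases lt_trichotomy i (-1) with h | rfl | h
  · rw [crossingPoint, crossingPoint, if_pos (by omega), if_pos (by omega)]
    rfl
  · rfl
  · rcases eq_or_ne i 0 with rfl | h0
    · rfl
    · rw [crossingPoint, crossingPoint, if_neg (by omega), if_neg h0, if_neg (by omega),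
        if_neg (by omega)]
      rfl

theorem crossingPoint_connects (t : ArrowOf G) :
    Connects (crossingPoint t) (loopAt G t.1.src) (loopAt G t.1.tgt) :=
  ⟨⟨-1, fun i hi => if_pos (by omega)⟩, 1, fun i hi => by
    rw [crossingPoint, if_neg (by omega), if_neg (by omega)]⟩

/-- Up to translation a nonconstant point is determined by its crossing edge, so orbits can be
counted by counting edges. -/
theorem eq_crossingPoint (hx : x ∈ arrowShift G) {N : ℤ} {u w : Fin n}
    (hs : (x N).1.src = (u, false)) (ht : (x N).1.tgt = (w, true)) :
    x = fun i => crossingPoint (x N) (i - N) := by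
  funext i
  simp only [crossingPoint]
  split_ifs with h1 h2
  · rw [hs]
    exact eq_loopAt_of_le hx hs (by omega)
  · rw [show i = N by omega]
  · rw [ht]
    exact eq_loopAt_of_ge hx ht (by omega)

/-! ### Recovering the graph from the connecting orbits -/

theorem linked_loopAt_iff {u w : Fin n} :
    Linked (arrowShift G) (loopAt G (u, false)) (loopAt G (w, true)) ↔ u = w ∨ G.Adj u w := by
  constructor
  · rintro ⟨x, hx, h⟩
    obtain ⟨N, u', w', e1, e2, hs, ht⟩ := exists_crossing hx h (fun e => by
      simpa using loopAt_injective e)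
    obtain rfl : u = u' := (Prod.ext_iff.1 (loopAt_injective e1)).1
    obtain rfl : w = w' := (Prod.ext_iff.1 (loopAt_injective e2)).1
    rcases hxN : x N with ⟨v | ⟨a, c⟩ | ⟨a, b⟩, hm⟩
    · rw [hxN] at hs ht
      simp [Arrow.src, Arrow.tgt] at hs ht
      simp [hs] at ht
    · rw [hxN] at hs ht
      simp [Arrow.src, Arrow.tgt] at hs ht
      exact Or.inl (hs.symm.trans ht)
    · rw [hxN] at hs ht
      simp [Arrow.src, Arrow.tgt] at hs ht
      subst hs ht
      exact Or.inr (mem_arrowList.1 hm _ _ rfl)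
  · rintro (rfl | h)
    · exact ⟨_, crossingPoint_mem ⟨.link u true, by simp [mem_arrowList]⟩,
        crossingPoint_connects _⟩
    · refine ⟨_, crossingPoint_mem ⟨.entry u w, mem_arrowList.2 fun i j e => ?_⟩,
        crossingPoint_connects _⟩
      obtain ⟨rfl, rfl⟩ := Arrow.entry.inj e
      exact h

theorem twinLinked_loopAt (u : Fin n) :
    TwinLinked (arrowShift G) (loopAt G (u, false)) (loopAt G (u, true)) := by
  refine ⟨_, crossingPoint_mem ⟨.link u true, by simp [mem_arrowList]⟩,
    _, crossingPoint_mem ⟨.link u false, by simp [mem_arrowList]⟩, crossingPoint_connects _,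
    crossingPoint_connects _, fun t h => ?_⟩
  have := congrArg Subtype.val (congrFun h 0)
  simp only [crossingPoint, zero_add, lt_self_iff_false, if_false, if_true] at this
  split_ifs at this <;> simp [loopAt] at this

/-- Between the source of `u` and the sink of `w ≠ u` there is at most one edge, hence at most one
orbit; and only the constant point connects a fixed point to itself. -/
theorem exists_of_twinLinked {p q : ArrowOf G} (h : TwinLinked (arrowShift G) p q)
    (hp : p ∈ fixedLetters (arrowShift G)) :
    ∃ u, p = loopAt G (u, false) ∧ q = loopAt G (u, true) := by
  obtain ⟨x, hx, y, hy, hcx, hcy, hne⟩ := h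
  by_cases hpq : p = q
  · subst hpq
    have hconst : ∀ z ∈ arrowShift G, Connects z p p → z = fun _ => p := by
      intro z hz hc
      rcases constant_or_crossing hz with ⟨v, rfl⟩ | ⟨N, u, w, hs, ht⟩
      · obtain ⟨e1, -⟩ := hc.unique ⟨⟨0, fun _ _ => rfl⟩, 0, fun _ _ => rfl⟩
        rw [e1]
      · obtain ⟨e1, e2⟩ := hc.unique (connects_of_crossing hz hs ht)
        simpa using loopAt_injective (e1.symm.trans e2)
    refine absurd ?_ (hne 0)
    rw [hconst x hx hcx, hconst y hy hcy]
  · obtain ⟨N, u, w, rfl, rfl, hs, ht⟩ := exists_crossing hx hcx hpq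
    obtain ⟨M, u', w', e1, e2, hs', ht'⟩ := exists_crossing hy hcy hpq
    obtain rfl : u = u' := (Prod.ext_iff.1 (loopAt_injective e1)).1
    obtain rfl : w = w' := (Prod.ext_iff.1 (loopAt_injective e2)).1
    by_cases huw : u = w
    · exact ⟨u, rfl, by rw [huw]⟩
    · have hentry : ∀ t : Arrow n, t.src = (u, false) → t.tgt = (w, true) → t = .entry u w := by
        rintro (v | ⟨a, c⟩ | ⟨a, b⟩) h h'
        · simp_all [Arrow.src, Arrow.tgt]
        · simp only [Arrow.src, Arrow.tgt, Prod.mk.injEq, and_true] at h h'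
          exact absurd (h.symm.trans h') huw
        · simp_all [Arrow.src, Arrow.tgt]
      have he : x N = y M := Subtype.ext ((hentry _ hs ht).trans (hentry _ hs' ht').symm)
      refine absurd ?_ (hne (N - M))
      rw [eq_crossingPoint hy hs' ht', eq_crossingPoint hx hs ht, he]
      funext i
      congr 1
      ring

theorem shiftInvariant_arrowShift : ShiftInvariant (arrowShift G) := by
  intro x hx t i
  have := hx (i + t)
  rwa [show i + t + 1 = i + 1 + t by ring] at this

/-- Block conjugacy of the edge shifts forces the graphs to be isomorphic. -/
theorem iso_of_blockConjugate {k : ℕ} (h : BlockConjugate k (arrowShift G) (arrowShift H)) :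
    Nonempty (G ≃g H) := by
  obtain ⟨σ, hσ⟩ := exists_equiv_fixedLetters shiftInvariant_arrowShift
    (fun x hx => exists_connects hx) h
  let a : ∀ v, fixedLetters (arrowShift G) := fun v => ⟨loopAt G v, loopAt_mem_fixedLetters v⟩
  let b : ∀ v, fixedLetters (arrowShift H) := fun v => ⟨loopAt H v, loopAt_mem_fixedLetters v⟩
  have h1 : ∀ u, ∃ w, σ (a (u, false)) = b (w, false) ∧ σ (a (u, true)) = b (w, true) := by
    intro u
    obtain ⟨w, e1, e2⟩ := exists_of_twinLinked (((hσ (a (u, false)) (a (u, true))).2).1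
      (twinLinked_loopAt u)) (σ (a (u, false))).2
    exact ⟨w, Subtype.ext e1, Subtype.ext e2⟩
  -- Surjectivity of the vertex map: pull the twin relation back along `σ`.
  have h2 : ∀ w, ∃ u, σ (a (u, false)) = b (w, false) := by
    intro w
    have := ((hσ (σ.symm (b (w, false))) (σ.symm (b (w, true)))).2).2 (by
      rw [σ.apply_symm_apply, σ.apply_symm_apply]
      exact twinLinked_loopAt w)
    obtain ⟨u, e1, -⟩ := exists_of_twinLinked this (σ.symm (b (w, false))).2
    exact ⟨u, (σ.symm_apply_eq.1 (Subtype.ext e1)).symm⟩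
  choose τ hτ hτ' using h1
  have binj : ∀ {v w}, b v = b w → v = w := fun e => loopAt_injective (congrArg Subtype.val e)
  have hbij : Function.Bijective τ := by
    constructor
    · intro u u' e
      have : a (u, false) = a (u', false) := σ.injective (by rw [hτ, hτ, e])
      simpa using loopAt_injective (congrArg Subtype.val this)
    · intro w
      obtain ⟨u, hu⟩ := h2 w
      exact ⟨u, by simpa using binj ((hτ u).symm.trans hu)⟩
  refine ⟨⟨Equiv.ofBijective τ hbij, fun {u w} => ?_⟩⟩
  have hl := (hσ (a (u, false)) (a (w, true))).1
  rw [hτ, hτ', linked_loopAt_iff, linked_loopAt_iff, hbij.1.eq_iff] at hl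
  show H.Adj (τ u) (τ w) ↔ G.Adj u w
  -- The relation `Linked` always holds between the source and the sink of one vertex, so it says
  -- nothing on the diagonal; there irreflexivity of adjacency decides.
  by_cases huw : u = w
  · subst huw
    simp
  · simpa [huw] using hl.symm

end

/-- The graphs are isomorphic if and only if the edge shifts are `k`-block conjugate. -/
theorem blockConjugate_iff {k : ℕ} (hk : 1 ≤ k) (G H : FinGraph) :
    BlockConjugate k (toMultigraph G).edgeShift (toMultigraph H).edgeShift ↔
      Nonempty (G.2 ≃g H.2) := by
  rw [blockConjugate_edgeShift_iff]
  exact ⟨iso_of_blockConjugate, fun ⟨ψ⟩ => blockConjugate_of_iso hk ψ⟩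

end GraphToMultigraph

/-! ### A stack machine computing the construction -/

namespace GraphToMultigraph

open Computability Turing

/-! ### Timed reachability -/

/-- `b` is reached from `a` within `t` steps of `f`. -/
def ReachesIn {C : Type*} (f : C → Option C) (t : ℕ) (a b : C) : Prop :=
  ∃ s ≤ t, (flip bind f)^[s] (some a) = some b

namespace ReachesIn

variable {C : Type*} {f : C → Option C} {t t' : ℕ} {a b c : C}

theorem refl (a : C) : ReachesIn f 0 a a := ⟨0, le_rfl, rfl⟩

theorem mono (h : ReachesIn f t a b) (ht : t ≤ t') : ReachesIn f t' a b := by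
  obtain ⟨s, hs, h⟩ := h
  exact ⟨s, hs.trans ht, h⟩

theorem trans (h : ReachesIn f t a b) (h' : ReachesIn f t' b c) : ReachesIn f (t + t') a c := by
  obtain ⟨s, hs, h⟩ := h
  obtain ⟨s', hs', h'⟩ := h'
  exact ⟨s' + s, by omega, by rw [Function.iterate_add_apply, h, h']⟩

theorem single (h : f a = some b) : ReachesIn f 1 a b := ⟨1, le_rfl, h⟩

theorem head (h : f a = some b) (h' : ReachesIn f t b c) : ReachesIn f (t + 1) a c := by
  rw [add_comm]
  exact (single h).trans h'

/-- A loop over `0, …, n - 1` that prepends a word to its output in every round. -/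
theorem finRange {n T : ℕ} {A : Type*} (D : List (Fin n) → ℕ → List A → C)
    (w : Fin n → List A)
    (h : ∀ (i : Fin n) l o, ReachesIn f T (D (i :: l) i o) (D l (i + 1) (w i ++ o))) (o : List A) :
    ReachesIn f (n * T) (D (List.finRange n) 0 o)
      (D [] n ((List.finRange n).reverse.flatMap w ++ o)) := by
  -- The induction runs over splittings of the full range, so that the loop index is the length of
  -- the part already processed.
  have key : ∀ (post pre : List (Fin n)) (o : List A), List.finRange n = pre ++ post →
      ReachesIn f (post.length * T) (D post pre.length o)
        (D [] n (post.reverse.flatMap w ++ o)) := by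
    intro post
    induction post with
    | nil =>
      intro pre o e
      have : pre.length = n := by simpa using (congrArg List.length e).symm
      simpa [this] using refl (f := f) (D [] n o)
    | cons i post ih =>
      intro pre o e
      have hi : (i : ℕ) = pre.length := by
        have h1 : (List.finRange n)[pre.length]? = some i := by simp [e]
        obtain ⟨h2, h3⟩ := List.getElem?_eq_some_iff.1 h1
        simpa using (congrArg Fin.val h3).symm
      have h1 := h i post o
      rw [hi] at h1
      have h2 := ih (pre ++ [i]) (w i ++ o) (by simp [e])
      rw [List.length_append, List.length_singleton] at h2
      have h3 := h1.trans h2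
      rw [List.reverse_cons, List.flatMap_append, List.flatMap_singleton, List.append_assoc,
        List.length_cons, Nat.succ_mul, add_comm]
      exact h3
  simpa using key (List.finRange n) [] o rfl

end ReachesIn

/-! ### The machine -/

/-- The alphabet of all stacks. -/
abbrev Letter : Type := Γ' ⊕ Γ'

/-- The copy of the letter `c` in the first (`false`) or second (`true`) alphabet. -/
def tag (s : Bool) (c : Γ') : Letter := bif s then Sum.inr c else Sum.inl c

/-- The digit of the unary counters. -/
abbrev one : Letter := Sum.inl (Γ'.bit true)

/-- The stacks: input, output, two counters for the current row and column of the adjacency matrix,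
and one for copying counters. -/
inductive Stack
  | inp
  | out
  | row
  | col
  | tmp
  deriving DecidableEq

instance : Fintype Stack :=
  Fintype.ofList [.inp, .out, .row, .col, .tmp] fun x => by cases x <;> simp

/-- The kinds of edges, in the order in which they are written. -/
inductive Kind
  | entry
  | loopSrc
  | loopTgt
  | linkFalse
  | linkTrue
  deriving DecidableEq

instance : Fintype Kind :=
  Fintype.ofList [.entry, .loopSrc, .loopTgt, .linkFalse, .linkTrue] fun x => by cases x <;> simp

/-- The labels of the program. The first argument is the alphabet of the current input graph; the
argument of `copy` and `back` after the kind says whether the initial vertex is being written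
(after the terminal one). -/
inductive Label
  | read (s : Bool)
  | start (s : Bool) (e : Kind)
  | copy (s : Bool) (e : Kind) (p : Bool)
  | back (s : Bool) (e : Kind) (p : Bool)
  | colEnd (s : Bool)
  | rowEnd (s : Bool)
  | finish (s : Bool)
  deriving Fintype

/-- The counter that holds the initial (`true`) or terminal (`false`) vertex of an edge. -/
def Kind.counter : Kind → Bool → Stack
  | entry, false => .col
  | _, _ => .row

/-- The parity of the initial (`true`) or terminal (`false`) vertex of an edge. -/
def Kind.odd : Kind → Bool → Bool
  | loopSrc, _ => false
  | loopTgt, _ => true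
  | _, p => !p

/-- The label at which the program continues after writing an edge. -/
def Kind.next (s : Bool) : Kind → Label
  | entry => .colEnd s
  | loopSrc => .start s .loopTgt
  | loopTgt => .start s .linkFalse
  | linkFalse => .start s .linkTrue
  | linkTrue => .rowEnd s

open TM2.Stmt in
/-- The program. The graphs are written in the order opposite to that of the input, since the
output stack is filled from the bottom. -/
def program : Label → TM2.Stmt (fun _ : Stack => Letter) Label (Option Letter)
  | .read s => peek .inp (fun _ o => o) <|
      branch (fun v => v = some (tag s (.bit true)))
        (pop .inp (fun _ _ => none) <| goto fun _ => .start s .entry) <|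
      branch (fun v => v = some (tag s (.bit false)))
        (pop .inp (fun _ _ => none) <| goto fun _ => .colEnd s) <|
      branch (fun v => v = some (tag s .comma))
        (pop .inp (fun _ _ => none) <| goto fun _ => .start s .loopSrc) <|
      load (fun _ => none) <| goto fun _ => .finish s
  | .start s e => push .out (fun _ => tag (!s) .ket) <| goto fun _ => .copy s e false
  | .copy s e p => pop (e.counter p) (fun _ o => o) <|
      branch Option.isSome
        (load (fun _ => none) <| push .tmp (fun _ => one) <|
          push .out (fun _ => tag (!s) (.bit true)) <| push .out (fun _ => tag (!s) (.bit true)) <|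
          goto fun _ => .copy s e p) <|
      load (fun _ => none) <|
      branch (fun _ => e.odd p)
        (push .out (fun _ => tag (!s) (.bit true)) <|
          push .out (fun _ => tag (!s) (bif p then .bra else .comma)) <| goto fun _ => .back s e p)
        (push .out (fun _ => tag (!s) (bif p then .bra else .comma)) <| goto fun _ => .back s e p)
  | .back s e p => pop .tmp (fun _ o => o) <|
      branch Option.isSome
        (load (fun _ => none) <| push (e.counter p) (fun _ => one) <| goto fun _ => .back s e p) <|
      load (fun _ => none) <| goto fun _ => bif p then e.next s else .copy s e true
  | .colEnd s => push .col (fun _ => one) <| goto fun _ => .read s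
  | .rowEnd s => pop .col (fun _ o => o) <|
      branch Option.isSome (load (fun _ => none) <| goto fun _ => .rowEnd s) <|
      push .row (fun _ => one) <| goto fun _ => .read s
  | .finish s => pop .row (fun _ o => o) <|
      branch Option.isSome
        (load (fun _ => none) <| push .out (fun _ => tag (!s) (.bit true)) <|
          push .out (fun _ => tag (!s) (.bit true)) <| goto fun _ => .finish s) <|
      branch (fun _ => s) halt <| goto fun _ => .read true

/-- The machine that computes the reduction. -/
def machine : FinTM2 where
  K := Stack
  k₀ := .inp
  k₁ := .out
  Γ _ := Letter
  Λ := Label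
  main := .read false
  σ := Option Letter
  initialState := none
  m := program

abbrev Config : Type := TM2.Cfg (fun _ : Stack => Letter) Label (Option Letter)

abbrev step : Config → Option Config := TM2.step program

/-- The contents of the stacks. -/
def contents (i o r c t : List Letter) : Stack → List Letter
  | .inp => i
  | .out => o
  | .row => r
  | .col => c
  | .tmp => t

section

variable (i o r c t l : List Letter)

@[simp] theorem contents_inp : contents i o r c t .inp = i := rfl
@[simp] theorem contents_out : contents i o r c t .out = o := rfl
@[simp] theorem contents_row : contents i o r c t .row = r := rfl
@[simp] theorem contents_col : contents i o r c t .col = c := rfl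
@[simp] theorem contents_tmp : contents i o r c t .tmp = t := rfl

@[simp] theorem update_inp : Function.update (contents i o r c t) .inp l = contents l o r c t := by
  funext k; cases k <;> rfl

@[simp] theorem update_out : Function.update (contents i o r c t) .out l = contents i l r c t := by
  funext k; cases k <;> rfl

@[simp] theorem update_row : Function.update (contents i o r c t) .row l = contents i o l c t := by
  funext k; cases k <;> rfl

@[simp] theorem update_col : Function.update (contents i o r c t) .col l = contents i o r l t := by
  funext k; cases k <;> rfl

@[simp] theorem update_tmp : Function.update (contents i o r c t) .tmp l = contents i o r c l := by
  funext k; cases k <;> rfl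

end

/-- A configuration with the scratch register empty and the counters at `r`, `c` and `t`. -/
def config (l : Option Label) (i o : List Letter) (r c t : ℕ) : Config :=
  ⟨l, none, contents i o (List.replicate r one) (List.replicate c one) (List.replicate t one)⟩

/-- The number `n` in unary, in the alphabet `s`. -/
def digits (s : Bool) (n : ℕ) : List Letter := (unaryWord n).map (tag s)

theorem digits_succ (s : Bool) (n : ℕ) : digits s (n + 1) = tag s (.bit true) :: digits s n := rfl

theorem digits_add_two (s : Bool) (n : ℕ) (o : List Letter) :
    digits s (n + 2) ++ o = digits s n ++ tag s (.bit true) :: tag s (.bit true) :: o := by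
  have : ∀ n (o : List Letter), digits s n ++ tag s (.bit true) :: o =
      tag s (.bit true) :: (digits s n ++ o) := by
    intro n o
    induction n with
    | zero => rfl
    | succ n ih => rw [digits_succ, List.cons_append, ih]; rfl
  rw [this, this, digits_succ, digits_succ]
  rfl

section

variable (s : Bool) (i o : List Letter) (r c t : ℕ)

/-- Each unit moved to the scratch counter writes two digits, since vertex indices are twice the
counter plus a parity; the parity digit and the separator come when the counter is empty. -/
theorem reachesIn_copy_row {e : Kind} {p : Bool} (h : e.counter p = .row) :
    ReachesIn step (r + 1) (config (some (.copy s e p)) i o r c t)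
      (config (some (.back s e p)) i (tag (!s) (bif p then .bra else .comma) ::
        (digits (!s) (2 * r + (e.odd p).toNat) ++ o)) 0 c (t + r)) := by
  induction r generalizing o t with
  | zero =>
    refine .single ?_
    cases ho : e.odd p <;> simp [step, config, program, h, ho, digits, unaryWord]
  | succ r ih =>
    refine .head (b := config (some (.copy s e p)) i
      (tag (!s) (.bit true) :: tag (!s) (.bit true) :: o) r c (t + 1)) ?_ ?_
    · simp [step, config, program, h, List.replicate_succ]
    · rw [show 2 * (r + 1) + (e.odd p).toNat = 2 * r + (e.odd p).toNat + 2 by ring,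
        digits_add_two, show t + (r + 1) = t + 1 + r by ring]
      exact ih _ _

theorem reachesIn_copy_col {e : Kind} {p : Bool} (h : e.counter p = .col) :
    ReachesIn step (c + 1) (config (some (.copy s e p)) i o r c t)
      (config (some (.back s e p)) i (tag (!s) (bif p then .bra else .comma) ::
        (digits (!s) (2 * c + (e.odd p).toNat) ++ o)) r 0 (t + c)) := by
  induction c generalizing o t with
  | zero =>
    refine .single ?_
    cases ho : e.odd p <;> simp [step, config, program, h, ho, digits, unaryWord]
  | succ c ih =>
    refine .head (b := config (some (.copy s e p)) i
      (tag (!s) (.bit true) :: tag (!s) (.bit true) :: o) r c (t + 1)) ?_ ?_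
    · simp [step, config, program, h, List.replicate_succ]
    · rw [show 2 * (c + 1) + (e.odd p).toNat = 2 * c + (e.odd p).toNat + 2 by ring,
        digits_add_two, show t + (c + 1) = t + 1 + c by ring]
      exact ih _ _

theorem reachesIn_back_row {e : Kind} {p : Bool} (h : e.counter p = .row) :
    ReachesIn step (t + 1) (config (some (.back s e p)) i o r c t)
      (config (some (bif p then e.next s else .copy s e true)) i o (r + t) c 0) := by
  induction t generalizing r with
  | zero => exact .single (by simp [step, config, program])
  | succ t ih =>
    refine .head (b := config (some (.back s e p)) i o (r + 1) c t) ?_ ?_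
    · simp [step, config, program, h, List.replicate_succ]
    · rw [show r + (t + 1) = r + 1 + t by ring]
      exact ih (r + 1)

theorem reachesIn_back_col {e : Kind} {p : Bool} (h : e.counter p = .col) :
    ReachesIn step (t + 1) (config (some (.back s e p)) i o r c t)
      (config (some (bif p then e.next s else .copy s e true)) i o r (c + t) 0) := by
  induction t generalizing c with
  | zero => exact .single (by simp [step, config, program])
  | succ t ih =>
    refine .head (b := config (some (.back s e p)) i o r (c + 1) t) ?_ ?_
    · simp [step, config, program, h, List.replicate_succ]
    · rw [show c + (t + 1) = c + 1 + t by ring]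
      exact ih (c + 1)

/-- The code of an edge from `a` to `b`, in the alphabet `s`. -/
def edgeWord (s : Bool) (a b : ℕ) : List Letter :=
  (Γ'.bra :: (unaryWord a ++ Γ'.comma :: (unaryWord b ++ [Γ'.ket]))).map (tag s)

theorem edgeWord_append (s : Bool) (a b : ℕ) (o : List Letter) :
    edgeWord s a b ++ o = tag s .bra :: (digits s a ++ tag s .comma ::
      (digits s b ++ tag s .ket :: o)) := by
  simp [edgeWord, digits]

/-- Each end point costs one pass to copy its counter and one to restore it. The terminal vertex is
written first, as the output stack is read from the top. -/
theorem reachesIn_start_entry :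
    ReachesIn step (2 * r + 2 * c + 5) (config (some (.start s .entry)) i o r c 0)
      (config (some (.colEnd s)) i (edgeWord (!s) (2 * r) (2 * c + 1) ++ o) r c 0) := by
  have h := ReachesIn.head (b := config (some (.copy s .entry false)) i (tag (!s) .ket :: o) r c 0)
    (a := config (some (.start s .entry)) i o r c 0) (by simp [step, config, program])
    ((reachesIn_copy_col s i _ r c 0 rfl).trans ((reachesIn_back_col s i _ r 0 (0 + c) rfl).trans
      ((reachesIn_copy_row s i _ r _ 0 rfl).trans (reachesIn_back_row s i _ 0 _ _ rfl))))
  rw [edgeWord_append]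
  simp only [zero_add] at h
  exact h.mono (by omega)

theorem reachesIn_start_row {e : Kind} (he : e.counter false = .row) (he' : e.counter true = .row) :
    ReachesIn step (4 * r + 5) (config (some (.start s e)) i o r c 0)
      (config (some (e.next s)) i (edgeWord (!s) (2 * r + (e.odd true).toNat)
        (2 * r + (e.odd false).toNat) ++ o) r c 0) := by
  have h := ReachesIn.head (b := config (some (.copy s e false)) i (tag (!s) .ket :: o) r c 0)
    (a := config (some (.start s e)) i o r c 0) (by simp [step, config, program])
    ((reachesIn_copy_row s i _ r c 0 he).trans ((reachesIn_back_row s i _ 0 c (0 + r) he).trans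
      ((reachesIn_copy_row s i _ _ _ 0 he').trans (reachesIn_back_row s i _ 0 _ _ he'))))
  rw [edgeWord_append]
  simp only [zero_add] at h
  exact h.mono (by omega)

/-- The column counter is emptied before the next row. -/
theorem reachesIn_rowEnd :
    ReachesIn step (c + 1) (config (some (.rowEnd s)) i o r c 0)
      (config (some (.read s)) i o (r + 1) 0 0) := by
  induction c with
  | zero => exact .single (by simp [step, config, program, List.replicate_succ])
  | succ c ih =>
    exact .head (by simp [step, config, program, List.replicate_succ]) ih

theorem reachesIn_finish :
    ReachesIn step (r + 1) (config (some (.finish s)) i o r 0 0)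
      (config (bif s then none else some (.read true)) i (digits (!s) (2 * r) ++ o) 0 0 0) := by
  induction r generalizing o with
  | zero => exact .single (by cases s <;> simp [step, config, program, digits, unaryWord])
  | succ r ih =>
    rw [mul_add, mul_one, digits_add_two]
    exact .head (b := config (some (.finish s)) i _ r 0 0)
      (by simp [step, config, program, List.replicate_succ]) (ih _)

end

/-! ### The words that the machine writes -/

def arrowWord {n : ℕ} (s : Bool) (t : Arrow n) : List Letter :=
  edgeWord s (node t.src) (node t.tgt)

theorem map_tag_encodeDiMultigraph (s : Bool) (G : FinGraph) :
    (encodeDiMultigraph (toMultigraph G)).map (tag s) = digits s (2 * G.1) ++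
      (List.finRange G.1).reverse.flatMap fun i => (rowArrows G.2 i).flatMap (arrowWord s) := by
  simp only [encodeDiMultigraph, toMultigraph, arrowList, digits, List.map_append,
    List.map_flatMap, List.flatMap_map, List.flatMap_assoc]
  rfl

open Classical in
/-- The row `i` of the adjacency matrix of `G`. -/
noncomputable def rowCode {n : ℕ} (G : SimpleGraph (Fin n)) (i : Fin n) : List Γ' :=
  ((List.finRange n).map fun j => Γ'.bit (decide (G.Adj i j))) ++ [Γ'.comma]

section

variable {n : ℕ} (G : SimpleGraph (Fin n)) (s : Bool)

theorem tag_injective : Function.Injective (tag s) := by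
  intro a b h
  cases s
  · exact Sum.inl_injective h
  · exact Sum.inr_injective h

theorem reachesIn_row (r : Fin n) (i o : List Letter) :
    ReachesIn step (n * (4 * n + 7) + 17 * n + 22)
      (config (some (.read s)) ((rowCode G r).map (tag s) ++ i) o r 0 0)
      (config (some (.read s)) i ((rowArrows G r).flatMap (arrowWord (!s)) ++ o) (r + 1) 0 0) := by
  classical
  have hr := r.2
  have hread : ∀ (b : Bool) (i o : List Letter) (c : ℕ),
      step (config (some (.read s)) (tag s (.bit b) :: i) o r c 0) =
        some (config (some (bif b then .start s .entry else .colEnd s)) i o r c 0) := by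
    intro b i o c
    cases b <;> simp [step, config, program, (tag_injective s).eq_iff]
  have hcol : ∀ (i o : List Letter) (c : ℕ), step (config (some (.colEnd s)) i o r c 0) =
      some (config (some (.read s)) i o r (c + 1) 0) := by
    intro i o c
    simp [step, config, program, List.replicate_succ]
  have h1 := ReachesIn.finRange (f := step) (T := 4 * n + 7)
    (fun l c o => config (some (.read s)) (l.map (fun j => tag s (.bit (decide (G.Adj r j)))) ++
      tag s .comma :: i) o r c 0)
    (fun j => (if G.Adj r j then [Arrow.entry r j] else []).flatMap (arrowWord (!s))) (by
      intro j l o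
      have hj := j.2
      -- Besides writing the edge, one step reads the bit and one advances the column.
      refine ReachesIn.mono (t := 2 * r + 2 * j + 5 + 1 + 1) (.head (hread _ _ _ _) ?_) (by omega)
      by_cases hadj : G.Adj r j
      · simp only [hadj, decide_true, cond_true, if_true, List.flatMap_singleton]
        exact (reachesIn_start_entry s _ _ r j).trans (.single (hcol _ _ _))
      · simp only [hadj, decide_false, cond_false, if_false, List.flatMap_nil, List.nil_append]
        exact ReachesIn.mono (.single (hcol _ _ _)) (by omega)) o
  have hcomma : ∀ o, step (config (some (.read s)) (tag s .comma :: i) o r n 0) =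
      some (config (some (.start s .loopSrc)) i o r n 0) := by
    intro o
    simp [step, config, program, (tag_injective s).eq_iff]
  have h2 := h1.trans (.head (hcomma _) ((reachesIn_start_row s i _ r n rfl rfl).trans
    ((reachesIn_start_row s i _ r n (e := .loopTgt) rfl rfl).trans
    ((reachesIn_start_row s i _ r n (e := .linkFalse) rfl rfl).trans
    ((reachesIn_start_row s i _ r n (e := .linkTrue) rfl rfl).trans
      (reachesIn_rowEnd s i _ r n))))))
  -- After the columns: one step for the comma, `4 * (4 * r + 5)` for the loops and links, `n + 1`
  -- to end the row.
  have h3 := h2.mono (t' := n * (4 * n + 7) + 17 * n + 22) (by omega)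
  convert h3 using 2
  · simp [rowCode, Function.comp_def]
  · simp [rowArrows, List.flatMap_assoc, arrowWord, node, Arrow.src, Arrow.tgt, Kind.odd]

/-- Reading one of the two graphs. -/
theorem reachesIn_graph (G : FinGraph) (i o : List Letter)
    (hi : ∀ c, i.head? ≠ some (tag s c)) :
    ReachesIn step (G.1 * (G.1 * (4 * G.1 + 7) + 17 * G.1 + 22) + G.1 + 2)
      (config (some (.read s)) ((encodeFinGraph G).map (tag s) ++ i) o 0 0 0)
      (config (bif s then none else some (.read true)) i
        ((encodeDiMultigraph (toMultigraph G)).map (tag !s) ++ o) 0 0 0) := by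
  have h1 := ReachesIn.finRange (f := step)
    (fun l r o => config (some (.read s))
      ((l.flatMap (rowCode G.2)).map (tag s) ++ i) o r 0 0)
    (fun r => (rowArrows G.2 r).flatMap (arrowWord (!s)))
    (fun r l o => by
      rw [List.flatMap_cons, List.map_append, List.append_assoc]
      exact reachesIn_row G.2 s r _ o) o
  -- The graph is over when the next letter is not in the alphabet `s`; it is only peeked at, so it
  -- stays for the second graph.
  have h2 : ∀ o, step (config (some (.read s)) i o G.1 0 0) =
      some (config (some (.finish s)) i o G.1 0 0) := by
    intro o
    simp [step, config, program, hi]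
  rw [map_tag_encodeDiMultigraph, List.append_assoc]
  exact (h1.trans (.head (h2 _) (reachesIn_finish s i _ G.1))).mono (by omega)

end

/-! ### The polynomial time bound -/

theorem length_le_encodeFinGraph (G : FinGraph) : G.1 ≤ (encodeFinGraph G).length := by
  rw [encodeFinGraph, List.length_flatMap]
  simp only [List.length_append, List.length_map, List.length_finRange, List.length_singleton,
    List.map_const', List.sum_replicate, smul_eq_mul]
  exact Nat.le_mul_of_pos_right _ (Nat.succ_pos _)

/-- The pair of multigraphs attached to a pair of graphs, in the opposite order. -/
noncomputable def reduction (p : FinGraph × FinGraph) : DiMultigraph × DiMultigraph :=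
  (toMultigraph p.2, toMultigraph p.1)

theorem reachesIn_reduction (p : FinGraph × FinGraph) :
    ReachesIn step
      (8 * (encodePair encodeFinGraph p).length ^ 3 + 48 * (encodePair encodeFinGraph p).length ^ 2
        + 46 * (encodePair encodeFinGraph p).length + 4)
      (config (some (.read false)) (encodePair encodeFinGraph p) [] 0 0 0)
      (config none [] (encodePair encodeDiMultigraph (reduction p)) 0 0 0) := by
  have h1 := reachesIn_graph false p.1 ((encodeFinGraph p.2).map (tag true)) [] (by
    intro c
    cases encodeFinGraph p.2 <;> simp [tag])
  have h2 := reachesIn_graph true p.2 []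
    ((encodeDiMultigraph (toMultigraph p.1)).map (tag true)) (by simp)
  simp only [List.append_nil] at h1 h2
  refine ReachesIn.mono (h1.trans h2) ?_
  have hL : (encodePair encodeFinGraph p).length =
      (encodeFinGraph p.1).length + (encodeFinGraph p.2).length := by simp [encodePair]
  -- Each graph costs a cubic in its number of vertices, which the input length bounds; the total
  -- bound is twice this cubic.
  have hb : ∀ n : ℕ, n ≤ (encodePair encodeFinGraph p).length →
      n * (n * (4 * n + 7) + 17 * n + 22) + n + 2 ≤
      4 * (encodePair encodeFinGraph p).length ^ 3 + 24 * (encodePair encodeFinGraph p).length ^ 2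
        + 23 * (encodePair encodeFinGraph p).length + 2 := by
    intro n hn
    calc _ = 4 * n ^ 3 + 24 * n ^ 2 + 23 * n + 2 := by ring
      _ ≤ _ := by gcongr
  have e1 := hb p.1.1 ((length_le_encodeFinGraph p.1).trans (by omega))
  have e2 := hb p.2.1 ((length_le_encodeFinGraph p.2).trans (by omega))
  omega

theorem initList_machine (l : List Letter) :
    initList machine l = config (some (.read false)) l [] 0 0 0 := by
  refine congrArg (TM2.Cfg.mk _ _) (funext fun k => ?_)
  cases k <;> rfl

theorem haltList_machine (l : List Letter) :
    haltList machine l = config none [] l 0 0 0 := by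
  refine congrArg (TM2.Cfg.mk _ _) (funext fun k => ?_)
  cases k <;> rfl

open Polynomial in
/-- The reduction is computable in polynomial time. -/
noncomputable def reductionComputable :
    TM2ComputableInPolyTime (encodePair encodeFinGraph) (encodePair encodeDiMultigraph)
      reduction where
  tm := machine
  inputAlphabet := Equiv.refl _
  outputAlphabet := Equiv.refl _
  time := 8 * X ^ 3 + 48 * X ^ 2 + 46 * X + 4
  outputsFun p := by
    have h := reachesIn_reduction p
    -- The machine's alphabets are matched with those of the encodings by identity maps, so the
    -- words must appear as images under `id`.
    rw [← List.map_id (encodePair encodeFinGraph p),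
      ← List.map_id (encodePair encodeDiMultigraph (reduction p)), ← initList_machine,
      ← haltList_machine] at h
    refine ⟨⟨h.choose, ?_⟩, ?_⟩
    · exact h.choose_spec.2
    · simpa using h.choose_spec.1

end GraphToMultigraph

theorem mainTheorem12 (k : ℕ) (hk : 1 ≤ k) :
    IsGIHard (encodePair encodeDiMultigraph) (EdgeBlockConjugacyProblem k) := by
  refine ⟨GraphToMultigraph.reduction, fun p => ?_, ⟨GraphToMultigraph.reductionComputable⟩⟩
  -- The reduction swaps the two graphs, which is harmless since isomorphisms can be inverted.
  exact (Equiv.nonempty_congr ⟨RelIso.symm, RelIso.symm, fun _ => rfl, fun _ => rfl⟩).trans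
    (GraphToMultigraph.blockConjugate_iff hk p.2 p.1).symm
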